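/- For a real Banach space $X$ with closed unit ball $B_X$, let $\mathcal{AK}(B_X)$ be the set of all weakly compact subsets of $B_X$, endowed with the binary relations $K\le_t L :\Leftrightarrow K\subseteq L+tB_X$ ($t>0$). Let $\omega^\omega$ be the set of all sequences of natural numbers with the pointwise order $\le$, endowed with the relations $\le_t\,:=\,\le$ for all $t>0$. For two sets $P,Q$ endowed with families of binary relations $\{\le_t\}_{t>0}$ write $P\preceq Q$ if there are functions $f_\varepsilon:P\to Q$ ($\varepsilon>0$) such that for every $\varepsilon>0$ there is $\delta>0$ with the following property: for every $q_0\in Q$ there is $p_0\in P$ such that $p\le_\varepsilon p_0$ for all $p\in P$ with $f_\varepsilon(p)\le_\delta q_0$. Write $P\sim Q$ if $P\preceq Q$ and $Q\preceq P$. The space $X$ is called strongly weakly compactly generated (SWCG) if there is a weakly compact set $K\subseteq X$ such that for every $\varepsilon>0$ and every weakly compact set $L\subseteq X$ there is $n\in\{0,1,2,\dots\}$ with $L\subseteq nK+\varepsilon B_X$. A sequence $(e_n)$ of non-zero vectors of $X$ is an unconditional basic sequence if there is $C>0$ such that $\|\sum_{n\in G}a_ne_n\|\le C\|\sum_{n\in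 F}a_ne_n\|$ for all finite sets $G\subseteq F$ of indices and all real scalars $a_n$. **Theorem.** There is a closed linear subspace $Y$ of $L^1[0,1]$ (Lebesgue measure, real scalars) such that $Y$ is the closed linear span of an unconditional basic sequence $(f_n)_{n\in\mathbb N}$ in $L^1[0,1]$ consisting of independent functions with $\int_0^1 f_n\,d\lambda=0$ for all $n$, and such that $\mathcal{AK}(B_Y)\sim\omega^\omega$. In particular, $Y$ is not SWCG. -/

import Mathlib

open MeasureTheory ProbabilityTheory
open scoped Pointwise

/-- `f : U → V` is a Tukey function from `(U, R)` to `(V, S)`. -/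
def IsTukey {U V : Type*} (R : U → U → Prop) (S : V → V → Prop) (f : U → V) : Prop :=
  ∀ v₀ : V, ∃ u₀ : U, ∀ u : U, S (f u) v₀ → R u u₀

/-- An asymptotic structure on the set `P`: a family of binary relations `≤_t`, indexed by the real
numbers `t > 0` (the values of `rel t` for `t ≤ 0` are never used), which are reflexive, increasing
in `t`, and whose intersection over all `t > 0` is a partial order. -/
structure AsymptoticStructure (P : Type*) where
  /-- the relation `≤_t`, for `t > 0` -/
  rel : ℝ → P → P → Prop
  refl : ∀ t : ℝ, 0 < t → ∀ p : P, rel t p p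
  mono : ∀ t s : ℝ, 0 < t → t < s → ∀ p q : P, rel t p q → rel s p q
  isPartialOrder : IsPartialOrder P (fun p q => ∀ t : ℝ, 0 < t → rel t p q)

namespace AsymptoticStructure

/-- A poset, viewed as an asymptotic structure with `≤_t` equal to `≤` for all `t > 0`. -/
def ofPoset (P : Type*) [PartialOrder P] : AsymptoticStructure P where
  rel _ p q := p ≤ q
  refl _ _ p := le_refl p
  mono _ _ _ _ _ _ h := h
  isPartialOrder :=
    { refl := fun p _ _ => le_refl p
      trans := fun _ _ _ h h' t ht => (h t ht).trans (h' t ht)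
      antisymm := fun _ _ h h' => le_antisymm (h 1 one_pos) (h' 1 one_pos) }

/-- Tukey reducibility `P ≼ Q` of asymptotic structures: there is a family of functions
`f_ε : P → Q`, `ε > 0`, such that for every `ε > 0` there is `δ > 0` for which
`f_ε : (P, ≤_ε) → (Q, ≤_δ)` is Tukey. -/
def TukeyReducible {P Q : Type*} (A : AsymptoticStructure P) (B : AsymptoticStructure Q) : Prop :=
  ∃ f : ℝ → P → Q, ∀ ε : ℝ, 0 < ε → ∃ δ : ℝ, 0 < δ ∧ IsTukey (A.rel ε) (B.rel δ) (f ε)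

/-- Tukey equivalence `P ∼ Q` of asymptotic structures. -/
def TukeyEquivalent {P Q : Type*} (A : AsymptoticStructure P) (B : AsymptoticStructure Q) : Prop :=
  A.TukeyReducible B ∧ B.TukeyReducible A

end AsymptoticStructure

section Banach

/-- `K ⊆ X` is compact in the weak topology of `X`. -/
def IsWeaklyCompact {X : Type*} [NormedAddCommGroup X] [NormedSpace ℝ X] (K : Set X) : Prop :=
  IsCompact (toWeakSpace ℝ X '' K)

theorem IsWeaklyCompact.isClosed {X : Type*} [NormedAddCommGroup X] [NormedSpace ℝ X] {K : Set X}
    (hK : IsWeaklyCompact K) : IsClosed K := by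
  have : T2Space (WeakSpace ℝ X) := inferInstance
  have h : IsClosed (toWeakSpace ℝ X '' K) := IsCompact.isClosed hK
  have h2 := h.preimage (toWeakSpaceCLM ℝ X).continuous
  have h3 : (toWeakSpaceCLM ℝ X) ⁻¹' (toWeakSpace ℝ X '' K) = K :=
    Set.preimage_image_eq K (toWeakSpace ℝ X).injective
  rwa [h3] at h2

/-- If `K ⊆ L + t B_X` for all `t > 0` and `L` is norm closed, then `K ⊆ L`. -/
theorem subset_of_forall_subset_add_ball {X : Type*} [NormedAddCommGroup X] [NormedSpace ℝ X]
    {K L : Set X} (hL : IsClosed L)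
    (h : ∀ t : ℝ, 0 < t → K ⊆ L + t • Metric.closedBall (0 : X) 1) : K ⊆ L := by
  intro x hx
  rw [← hL.closure_eq, Metric.mem_closure_iff]
  intro ε hε
  obtain ⟨y, hy, z, hz, rfl⟩ := h (ε / 2) (half_pos hε) hx
  obtain ⟨w, hw, rfl⟩ := hz
  refine ⟨y, hy, ?_⟩
  have hw' : ‖w‖ ≤ 1 := by simpa using hw
  have : dist (y + (ε / 2) • w) y = (ε / 2) * ‖w‖ := by
    rw [dist_eq_norm, add_sub_cancel_left, norm_smul, Real.norm_of_nonneg (half_pos hε).le]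
  simp only [this]
  nlinarith

/-- The asymptotic structure `AK(E)` of a subset `E` of a normed space `X`: the underlying set is
the family of all weakly compact subsets of `E`, and `K ≤_t L` means `K ⊆ L + t B_X`. -/
def AK {X : Type*} [NormedAddCommGroup X] [NormedSpace ℝ X] (E : Set X) :
    AsymptoticStructure {K : Set X // K ⊆ E ∧ IsWeaklyCompact K} where
  rel t K L := (K : Set X) ⊆ (L : Set X) + t • Metric.closedBall (0 : X) 1
  refl t _ K := fun x hx => ⟨x, hx, 0, ⟨0, by simp, by simp⟩, by simp⟩
  mono t s ht hts K L h := by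
    refine h.trans (Set.add_subset_add_left ?_)
    rw [smul_unitClosedBall, smul_unitClosedBall, Real.norm_of_nonneg ht.le,
      Real.norm_of_nonneg (ht.trans hts).le]
    exact Metric.closedBall_subset_closedBall hts.le
  isPartialOrder :=
    { refl := fun K t _ x hx => ⟨x, hx, 0, ⟨0, by simp, by simp⟩, by simp⟩
      trans := fun K L M h h' t ht =>
        (subset_of_forall_subset_add_ball L.2.2.isClosed h).trans (h' t ht)
      antisymm := fun K L h h' => Subtype.ext (Set.Subset.antisymm
        (subset_of_forall_subset_add_ball L.2.2.isClosed h)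
        (subset_of_forall_subset_add_ball K.2.2.isClosed h')) }

/-- `X` is strongly weakly compactly generated. -/
def IsSWCG (X : Type*) [NormedAddCommGroup X] [NormedSpace ℝ X] : Prop :=
  ∃ K : Set X, IsWeaklyCompact K ∧ ∀ ε : ℝ, 0 < ε → ∀ L : Set X, IsWeaklyCompact L →
    ∃ n : ℕ, L ⊆ (n : ℝ) • K + ε • Metric.closedBall (0 : X) 1

/-- A sequence of non-zero vectors is an unconditional basic sequence if, for some constant `C`,
restricting a finite linear combination to a subset of its terms increases the norm at most by the
factor `C`. (This inequality forces the vectors to be pairwise distinct.) -/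
def IsUnconditionalBasicSequence {X : Type*} [NormedAddCommGroup X] [NormedSpace ℝ X]
    (e : ℕ → X) : Prop :=
  (∀ n, e n ≠ 0) ∧ ∃ C : ℝ, 0 < C ∧ ∀ G F : Finset ℕ, G ⊆ F → ∀ a : ℕ → ℝ,
    ‖∑ n ∈ G, a n • e n‖ ≤ C * ‖∑ n ∈ F, a n • e n‖

end Banach

/-! The space `Y` is a copy of `ℓ² ∩ ℓ¹(c)` inside `L¹`, where `ℕ` is read as `ℕ × ℕ` and the weight
is `2⁻ⁿ` on all of row `n`. The basis is `fᵢ = rᵢ + cᵢ gᵢ`: the `rᵢ` are standard Gaussians, which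
span `ℓ²`, and the `gᵢ` are normalised symmetric spikes on sets of summably small measure, which
span `ℓ¹`. All are independent with mean zero, so the norm of a sum dominates that of any partial
sum; hence the two-sided norm estimate (`exists_independent_mixed`) and unconditionality with
constant 1.

In such a space weakly compact sets have uniformly small weighted `ℓ¹`-tails (Schur's theorem, by a
gliding hump). Conversely, an `ℓ²` bound with prescribed tails defines a weakly compact set, because
a functional is an `ℓ²` part plus a part dominated by the weights. Recording where the tails drop
below `2⁻ᵏ` therefore codes a weakly compact set by an element of `ω^ω`, and all sets with code
below `ψ` lie in a single one. This gives `AK ≼ ω^ω`.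

For the other direction, send `φ` to `0` together with multiples of the vectors `e (n, φ n)`. As the
row weights tend to zero, this sequence is weakly null. Within one row the weight is a positive
constant, so the row behaves like `ℓ¹` for weak compactness and a slightly fattened weakly compact
set meets it in finitely many of these vectors: a bound for the image bounds `φ`. Diagonalising over
the multiples `jK` refutes SWCG. -/

open Filter Topology

/-! ### Weak compactness tested on functionals -/

section WeakTopology

variable {X : Type*} [NormedAddCommGroup X] [NormedSpace ℝ X]

theorem continuous_toWeakSpace_eval (φ : X →L[ℝ] ℝ) :
    Continuous fun x : WeakSpace ℝ X => φ ((toWeakSpace ℝ X).symm x) :=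
  WeakBilin.eval_continuous (topDualPairing ℝ X).flip φ

/-- Continuity into the weak topology can be tested on functionals. -/
theorem IsWeaklyCompact.image_of_continuousOn {Q : Type*} [TopologicalSpace Q] {D : Set Q}
    (hD : IsCompact D) (S : Q → X) (hS : ∀ φ : X →L[ℝ] ℝ, ContinuousOn (fun d => φ (S d)) D) :
    IsWeaklyCompact (S '' D) := by
  unfold IsWeaklyCompact
  rw [Set.image_image]
  refine hD.image_of_continuousOn ?_
  rw [continuousOn_iff_continuous_domRestrict]
  refine WeakBilin.continuous_of_continuous_eval (topDualPairing ℝ X).flip fun φ => ?_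
  exact continuousOn_iff_continuous_domRestrict.mp (hS φ)

theorem IsWeaklyCompact.image {V : Type*} [NormedAddCommGroup V] [NormedSpace ℝ V] {K : Set X}
    (hK : IsWeaklyCompact K) (T : X →L[ℝ] V) : IsWeaklyCompact (T '' K) := by
  have := IsWeaklyCompact.image_of_continuousOn hK (fun x => T ((toWeakSpace ℝ X).symm x))
    fun φ => (continuous_toWeakSpace_eval (φ.comp T)).continuousOn
  rw [Set.image_image] at this
  simpa using this

/-- Mazur's theorem: norm closed convex sets are weakly closed. -/
theorem IsWeaklyCompact.inter_closed_convex {K C : Set X} (hK : IsWeaklyCompact K)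
    (hC : IsClosed C) (hconv : Convex ℝ C) : IsWeaklyCompact (K ∩ C) := by
  unfold IsWeaklyCompact
  rw [Set.image_inter (toWeakSpace ℝ X).injective]
  refine IsCompact.inter_right hK ?_
  rw [← hC.closure_eq, hconv.toWeakSpace_closure ℝ]
  exact isClosed_closure

/-- A weakly null sequence together with `0` is weakly compact. -/
theorem isWeaklyCompact_insert_zero_range {x : ℕ → X}
    (hx : ∀ φ : X →L[ℝ] ℝ, Tendsto (fun n => φ (x n)) atTop (𝓝 0)) :
    IsWeaklyCompact (insert 0 (Set.range x)) := by
  unfold IsWeaklyCompact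
  rw [Set.image_insert_eq, ← Set.range_comp]
  refine Tendsto.isCompact_insert_range ?_
  have hind : IsInducing fun (w : WeakSpace ℝ X) (φ : X →L[ℝ] ℝ) => φ ((toWeakSpace ℝ X).symm w) :=
    ⟨rfl⟩
  refine hind.tendsto_nhds_iff.mpr (tendsto_pi_nhds.mpr fun φ => ?_)
  simpa using hx φ

/-- A sequence in a weakly compact set converges weakly along some ultrafilter. -/
theorem IsWeaklyCompact.exists_ultrafilter_tendsto {K : Set X} (hK : IsWeaklyCompact K)
    {x : ℕ → X} (hx : ∀ n, x n ∈ K) :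
    ∃ z ∈ K, ∃ U : Ultrafilter ℕ, (U : Filter ℕ) ≤ atTop ∧
      ∀ φ : X →L[ℝ] ℝ, Tendsto (fun n => φ (x n)) U (𝓝 (φ z)) := by
  -- An ultrafilter finer than `atTop` replaces a weakly convergent subsequence, so Eberlein–Šmulian
  -- is avoided.
  let U : Ultrafilter ℕ := Ultrafilter.of atTop
  have hK' : IsCompact (toWeakSpace ℝ X '' K) := hK
  obtain ⟨w, ⟨z, hz, rfl⟩, hw⟩ := hK'.ultrafilter_le_nhds (U.map fun n => toWeakSpace ℝ X (x n))
    (by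
      rw [Filter.le_principal_iff]
      exact Filter.mem_map.mpr (Filter.univ_mem' fun n => Set.mem_image_of_mem _ (hx n)))
  refine ⟨z, hz, U, Ultrafilter.of_le _, fun φ => ?_⟩
  have h1 : Tendsto (fun n => toWeakSpace ℝ X (x n)) U (𝓝 (toWeakSpace ℝ X z)) := hw
  exact ((continuous_toWeakSpace_eval φ).tendsto _).comp h1

end WeakTopology

/-! ### Schur's theorem by a gliding hump -/

section UniformTails

variable {X : Type*} [NormedAddCommGroup X] [NormedSpace ℝ X]

theorem summable_abs_of_sum_le {t : ℕ → ℝ} {M : ℝ} (h : ∀ F : Finset ℕ, ∑ i ∈ F, |t i| ≤ M) :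
    Summable fun i => |t i| :=
  summable_of_sum_le (fun _ => abs_nonneg _) h

/-- The tails of an absolutely summable sequence are uniformly small on finite sets. -/
theorem exists_forall_sum_abs_le {t : ℕ → ℝ} (h : Summable fun i => |t i|) {ε : ℝ} (hε : 0 < ε) :
    ∃ N : ℕ, ∀ F : Finset ℕ, (∀ i ∈ F, N ≤ i) → ∑ i ∈ F, |t i| < ε := by
  obtain ⟨s, hs⟩ := summable_iff_vanishing_norm.mp h ε hε
  refine ⟨s.sup id + 1, fun F hF => ?_⟩
  have hd : Disjoint F s := by
    rw [Finset.disjoint_left]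
    intro i hi his
    have h1 : i ≤ s.sup id := Finset.le_sup (f := id) his
    have h2 := hF i hi
    omega
  exact (le_abs_self _).trans_lt (hs F hd)

/-- The functional `x ↦ ∑ uᵢ bᵢ(x)`, for bounded signs `u` and functionals `b` that are uniformly
absolutely summable. -/
theorem exists_signed_functional {b : ℕ → X →L[ℝ] ℝ} {M : ℝ}
    (hb : ∀ x, ∀ F : Finset ℕ, ∑ i ∈ F, |b i x| ≤ M * ‖x‖) {u : ℕ → ℝ} (hu : ∀ i, |u i| ≤ 1) :
    ∃ φ : X →L[ℝ] ℝ, ∀ x, HasSum (fun i => u i * b i x) (φ x) := by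
  have hs : ∀ x, Summable fun i => u i * b i x := fun x => by
    refine Summable.of_norm_bounded (summable_abs_of_sum_le (hb x)) fun i => ?_
    rw [Real.norm_eq_abs, abs_mul]
    exact mul_le_of_le_one_left (abs_nonneg _) (hu i)
  let L : X →ₗ[ℝ] ℝ :=
    { toFun := fun x => ∑' i, u i * b i x
      map_add' := fun x y => by
        rw [← (hs x).tsum_add (hs y)]
        simp only [map_add, mul_add]
      map_smul' := fun r x => by
        simp only [map_smul, smul_eq_mul, RingHom.id_apply]
        rw [← tsum_mul_left]
        congr 1; ext i; ring }
  refine ⟨L.mkContinuous M fun x => ?_, fun x => (hs x).hasSum⟩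
  have h1 : ‖∑' i, u i * b i x‖ ≤ ∑' i, |b i x| := by
    refine tsum_of_norm_bounded (summable_abs_of_sum_le (hb x)).hasSum fun i => ?_
    rw [Real.norm_eq_abs, abs_mul]
    exact mul_le_of_le_one_left (abs_nonneg _) (hu i)
  exact h1.trans ((summable_abs_of_sum_le (hb x)).tsum_le_of_sum_le (hb x))

/-- A sequence of points, each carrying its mass on its own block, is seen by one functional. -/
theorem exists_functional_of_blocks {b : ℕ → X →L[ℝ] ℝ} {M : ℝ}
    (hb : ∀ x, ∀ F : Finset ℕ, ∑ i ∈ F, |b i x| ≤ M * ‖x‖) {N : ℕ → ℕ} (hN : StrictMono N)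
    {d : ℕ → X} {ε : ℝ}
    (hhead : ∀ k, ∑ i ∈ Finset.range (N k), |b i (d k)| ≤ ε)
    (hblock : ∀ k, 4 * ε ≤ ∑ i ∈ Finset.Ico (N k) (N (k + 1)), |b i (d k)|)
    (htail : ∀ k, ∀ F : Finset ℕ, (∀ i ∈ F, N (k + 1) ≤ i) → ∑ i ∈ F, |b i (d k)| ≤ ε) :
    ∃ u : ℕ → ℝ, ∃ φ : X →L[ℝ] ℝ, (∀ x, HasSum (fun i => u i * b i x) (φ x)) ∧
      ∀ k, ε ≤ φ (d k) := by
  classical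
  -- The blocks are disjoint, so each index has to match the sign of at most one `d k`.
  have hex : ∀ i, ∃ s : ℝ, |s| ≤ 1 ∧
      ∀ k, N k ≤ i → i < N (k + 1) → s * b i (d k) = |b i (d k)| := by
    intro i
    by_cases h : ∃ k, N k ≤ i ∧ i < N (k + 1)
    · obtain ⟨k, hk1, hk2⟩ := h
      refine ⟨if 0 ≤ b i (d k) then 1 else -1, by split_ifs <;> simp, fun j hj1 hj2 => ?_⟩
      have hkj : j = k := by
        have h1 := hN.lt_iff_lt.mp (hk1.trans_lt hj2)
        have h2 := hN.lt_iff_lt.mp (hj1.trans_lt hk2)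
        omega
      subst hkj
      split_ifs with h0
      · rw [abs_of_nonneg h0, one_mul]
      · rw [abs_of_neg (not_le.mp h0)]; ring
    · exact ⟨0, by simp, fun k h1 h2 => absurd ⟨k, h1, h2⟩ h⟩
  choose u hu1 hu2 using hex
  obtain ⟨φ, hφ⟩ := exists_signed_functional hb hu1
  refine ⟨u, φ, hφ, fun k => ?_⟩
  -- Head, block and tail contribute at least `-ε`, `4ε` and `-ε` to every large partial sum.
  refine ge_of_tendsto (hφ (d k)) ?_
  filter_upwards [eventually_ge_atTop (Finset.range (N (k + 1)))] with F hF
  have hterm : ∀ i, -|b i (d k)| ≤ u i * b i (d k) := fun i => by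
    have : |u i * b i (d k)| ≤ |b i (d k)| := by
      rw [abs_mul]; exact mul_le_of_le_one_left (abs_nonneg _) (hu1 i)
    linarith [neg_abs_le (u i * b i (d k))]
  have hrange : ∑ i ∈ Finset.range (N (k + 1)), u i * b i (d k) ≥ 3 * ε := by
    rw [← Finset.sum_range_add_sum_Ico _ (hN (Nat.lt_succ_self k)).le]
    have h1 : ∑ i ∈ Finset.range (N k), -|b i (d k)| ≤
        ∑ i ∈ Finset.range (N k), u i * b i (d k) := Finset.sum_le_sum fun i _ => hterm i
    have h2 : ∑ i ∈ Finset.Ico (N k) (N (k + 1)), u i * b i (d k) =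
        ∑ i ∈ Finset.Ico (N k) (N (k + 1)), |b i (d k)| :=
      Finset.sum_congr rfl fun i hi => hu2 i k (Finset.mem_Ico.mp hi).1 (Finset.mem_Ico.mp hi).2
    rw [Finset.sum_neg_distrib] at h1
    linarith [hhead k, hblock k]
  have hrest : ∑ i ∈ F \ Finset.range (N (k + 1)), -|b i (d k)| ≤
      ∑ i ∈ F \ Finset.range (N (k + 1)), u i * b i (d k) := Finset.sum_le_sum fun i _ => hterm i
  rw [Finset.sum_neg_distrib] at hrest
  have h3 := htail k (F \ Finset.range (N (k + 1))) fun i hi => by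
    simpa using (Finset.mem_sdiff.mp hi).2
  rw [← Finset.sum_sdiff hF]
  have hε : 0 ≤ ε := le_trans (Finset.sum_nonneg fun i _ => abs_nonneg _) (hhead k)
  linarith

/-- Functionals that are uniformly absolutely summable have uniformly small tails on weakly compact
sets; this is Schur's theorem for `ℓ¹`. -/
theorem IsWeaklyCompact.exists_uniform_tail {b : ℕ → X →L[ℝ] ℝ} {M : ℝ}
    (hb : ∀ x, ∀ F : Finset ℕ, ∑ i ∈ F, |b i x| ≤ M * ‖x‖) {K : Set X} (hK : IsWeaklyCompact K)
    {ε : ℝ} (hε : 0 < ε) :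
    ∃ N : ℕ, ∀ x ∈ K, ∀ F : Finset ℕ, (∀ i ∈ F, N ≤ i) → ∑ i ∈ F, |b i x| ≤ ε := by
  by_contra! hcon
  choose x hxK F hF hFε using hcon
  obtain ⟨z, hz, U, hU, hlim⟩ := hK.exists_ultrafilter_tendsto hxK
  have hsum : ∀ y, Summable fun i => |b i y| := fun y => summable_abs_of_sum_le (hb y)
  -- Subtracting the limit `z` costs at most `η` of a mass exceeding `8η`, which leaves more than
  -- the `4η` a block requires.
  set η : ℝ := ε / 8 with hη
  have hη0 : 0 < η := by positivity
  obtain ⟨N₀, hN₀⟩ := exists_forall_sum_abs_le (hsum z) hη0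
  -- One hump: along `U` the coordinates of `x n - z` tend to zero, so the head becomes small while
  -- mass remains beyond `N`. The head bound has the factor `1 / (N + 1)` so that the coordinates of
  -- the hump sequence tend to zero along `atTop`.
  have hstep : ∀ N : {N : ℕ // N₀ ≤ N}, ∃ n : ℕ, ∃ N' : {N : ℕ // N₀ ≤ N}, (N : ℕ) < N' ∧
      ∑ i ∈ Finset.range N, |b i (x n - z)| ≤ η / ((N : ℕ) + 1) ∧
      4 * η ≤ ∑ i ∈ Finset.Ico (N : ℕ) N', |b i (x n - z)| ∧
      ∀ G : Finset ℕ, (∀ i ∈ G, (N' : ℕ) ≤ i) → ∑ i ∈ G, |b i (x n - z)| ≤ η := by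
    rintro ⟨N, hN⟩
    have h1 : Tendsto (fun n => ∑ i ∈ Finset.range N, |b i (x n - z)|) U (𝓝 0) := by
      have : Tendsto (fun n => ∑ i ∈ Finset.range N, |b i (x n - z)|) U
          (𝓝 (∑ i ∈ Finset.range N, |b i z - b i z|)) := by
        refine tendsto_finsetSum _ fun i _ => ?_
        simp only [map_sub]
        exact ((hlim (b i)).sub_const _).abs
      simpa using this
    have h2 : ∀ᶠ n in (U : Filter ℕ), ∑ i ∈ Finset.range N, |b i (x n - z)| < η / (N + 1) :=
      h1.eventually_lt_const (by positivity)
    obtain ⟨n, hn1, hn2⟩ := (h2.and (hU (eventually_ge_atTop N))).exists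
    obtain ⟨N₁, hN₁⟩ := exists_forall_sum_abs_le (hsum (x n - z)) hη0
    refine ⟨n, ⟨max N₁ (max (N + 1) ((F n).sup id + 1)), by omega⟩, by simp, hn1.le, ?_,
      fun G hG => (hN₁ G fun i hi => le_trans (le_max_left _ _) (hG i hi)).le⟩
    have h3 : F n ⊆ Finset.Ico N (max N₁ (max (N + 1) ((F n).sup id + 1))) := fun i hi => by
      have h4 : i ≤ (F n).sup id := Finset.le_sup (f := id) hi
      have := hF n i hi
      simp only [Finset.mem_Ico]
      omega
    have h5 : ∑ i ∈ F n, |b i (x n - z)| ≤ _ :=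
      Finset.sum_le_sum_of_subset_of_nonneg h3 fun i _ _ => abs_nonneg _
    have h6 : ∑ i ∈ F n, |b i (x n)| ≤ ∑ i ∈ F n, |b i (x n - z)| + ∑ i ∈ F n, |b i z| := by
      rw [← Finset.sum_add_distrib]
      refine Finset.sum_le_sum fun i _ => ?_
      have := abs_add_le (b i (x n - z)) (b i z)
      rwa [map_sub, sub_add_cancel, ← map_sub] at this
    have h7 := hN₀ (F n) fun i hi => (hN.trans hn2).trans (hF n i hi)
    have h8 := hFε n
    linarith
  choose n next hlt hhead hblock htail using hstep
  let N : ℕ → {N : ℕ // N₀ ≤ N} := fun k => next^[k] ⟨N₀, le_rfl⟩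
  have hsucc : ∀ k, N (k + 1) = next (N k) := fun k => Function.iterate_succ_apply' _ _ _
  have hmono : StrictMono fun k => (N k : ℕ) := strictMono_nat_of_lt_succ fun k => by
    rw [hsucc]; exact hlt _
  obtain ⟨u, φ, hφ, hφd⟩ := exists_functional_of_blocks hb hmono
    (d := fun k => x (n (N k)) - z) (ε := η)
    (fun k => (hhead (N k)).trans (div_le_self hη0.le (by simp)))
    (fun k => by rw [hsucc]; exact hblock (N k))
    (fun k => by rw [hsucc]; exact htail (N k))
  -- A weak cluster point `z'` of the humps has the coordinates of `z`, and `φ` depends on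
  -- coordinates only; yet `φ` stays at least `η` on the differences.
  obtain ⟨z', hz', U', hU', hlim'⟩ := hK.exists_ultrafilter_tendsto fun k => hxK (n (N k))
  have hcoord : ∀ i, b i z' = b i z := by
    intro i
    have h1 : Tendsto (fun k => b i (x (n (N k)) - z)) atTop (𝓝 0) := by
      have h2 : Tendsto (fun k : ℕ => η / ((k : ℝ) + 1)) atTop (𝓝 0) :=
        tendsto_const_nhds.div_atTop (tendsto_atTop_add_const_right _ _ tendsto_natCast_atTop_atTop)
      refine squeeze_zero_norm' ?_ h2
      filter_upwards [eventually_gt_atTop i] with k hk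
      have hk' : k ≤ N k := hmono.le_apply
      calc ‖b i (x (n (N k)) - z)‖ = |b i (x (n (N k)) - z)| := rfl
        _ ≤ ∑ j ∈ Finset.range (N k), |b j (x (n (N k)) - z)| :=
          Finset.single_le_sum (f := fun j => |b j (x (n (N k)) - z)|)
            (fun j _ => abs_nonneg _) (Finset.mem_range.mpr (by omega))
        _ ≤ η / ((N k : ℕ) + 1) := hhead (N k)
        _ ≤ η / (k + 1) := by gcongr
    have h3 : Tendsto (fun k => b i (x (n (N k)) - z)) U' (𝓝 (b i z' - b i z)) := by
      simp only [map_sub]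
      exact (hlim' (b i)).sub_const _
    have := tendsto_nhds_unique h3 (h1.mono_left hU')
    linarith
  have h0 : φ z' = φ z := by
    refine (hφ z').unique ?_
    simp only [hcoord]
    exact hφ z
  have h4 : Tendsto (fun k => φ (x (n (N k)) - z)) U' (𝓝 (φ z' - φ z)) := by
    simp only [map_sub]
    exact (hlim' φ).sub_const _
  have h5 : η ≤ φ z' - φ z := ge_of_tendsto h4 (Eventually.of_forall hφd)
  linarith

end UniformTails

/-! ### Coordinates and functionals in `ℓ² ∩ ℓ¹(c)` -/

section MixedBasis

variable {X : Type*} [NormedAddCommGroup X] [NormedSpace ℝ X]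

/-- The norm of `ℓ² ∩ ℓ¹(c)`, restricted to a finite set of coordinates. -/
noncomputable def mixedNorm (c : ℕ → ℝ) (F : Finset ℕ) (a : ℕ → ℝ) : ℝ :=
  √(∑ i ∈ F, a i ^ 2) + ∑ i ∈ F, c i * |a i|

/-- The vectors `e` span a dense subspace, on which the norm is equivalent to the norm of
`ℓ² ∩ ℓ¹(c)`. -/
structure IsMixedBasis (e : ℕ → X) (c : ℕ → ℝ) (A B : ℝ) : Prop where
  pos : ∀ i, 0 < c i
  A_pos : 0 < A
  B_pos : 0 < B
  lower : ∀ F a, mixedNorm c F a ≤ A * ‖∑ i ∈ F, a i • e i‖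
  upper : ∀ F a, ‖∑ i ∈ F, a i • e i‖ ≤ B * mixedNorm c F a
  dense : (Submodule.span ℝ (Set.range e)).topologicalClosure = ⊤

theorem mixedNorm_mono {c : ℕ → ℝ} (hc : ∀ i, 0 < c i) {F G : Finset ℕ} (h : F ⊆ G) (a : ℕ → ℝ) :
    mixedNorm c F a ≤ mixedNorm c G a :=
  add_le_add
    (Real.sqrt_le_sqrt (Finset.sum_le_sum_of_subset_of_nonneg h fun _ _ _ => sq_nonneg _))
    (Finset.sum_le_sum_of_subset_of_nonneg h fun _ _ _ => mul_nonneg (hc _).le (abs_nonneg _))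

namespace IsMixedBasis

variable {e : ℕ → X} {c : ℕ → ℝ} {A B : ℝ}

theorem denseRange_linearCombination (h : IsMixedBasis e c A B) :
    DenseRange (Finsupp.linearCombination ℝ e) := by
  have h1 : Set.range (Finsupp.linearCombination ℝ e) =
      (Submodule.span ℝ (Set.range e) : Set X) := by
    rw [← Finsupp.range_linearCombination, LinearMap.coe_range]
  rw [DenseRange, h1, dense_iff_closure_eq, ← Submodule.topologicalClosure_coe, h.dense]
  rfl

/-- The coordinate functionals. -/
noncomputable def coord (e : ℕ → X) (i : ℕ) : X →L[ℝ] ℝ :=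
  (Finsupp.lapply i : (ℕ →₀ ℝ) →ₗ[ℝ] ℝ).extendOfNorm (Finsupp.linearCombination ℝ e)

theorem mixedNorm_finsupp_le (h : IsMixedBasis e c A B) (F : Finset ℕ) (a : ℕ →₀ ℝ) :
    mixedNorm c F a ≤ A * ‖Finsupp.linearCombination ℝ e a‖ := by
  classical
  have h1 : Finsupp.linearCombination ℝ e a = ∑ i ∈ F ∪ a.support, a i • e i := by
    rw [Finsupp.linearCombination_apply]
    exact Finsupp.sum_of_support_subset _ Finset.subset_union_right _ (by simp)
  rw [h1]
  exact (mixedNorm_mono h.pos Finset.subset_union_left _).trans (h.lower _ _)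

/-- The lower norm estimate bounds the coefficient on the dense span, which is what makes the
extension defining `coord` agree with it there. -/
theorem coord_linearCombination (h : IsMixedBasis e c A B) (i : ℕ) (a : ℕ →₀ ℝ) :
    coord e i (Finsupp.linearCombination ℝ e a) = a i := by
  refine LinearMap.extendOfNorm_eq h.denseRange_linearCombination ⟨A, fun a => ?_⟩ a
  refine le_trans ?_ (h.mixedNorm_finsupp_le {i} a)
  simp only [mixedNorm, Finset.sum_singleton, Real.sqrt_sq_eq_abs, Finsupp.lapply_apply,
    Real.norm_eq_abs]
  nlinarith [h.pos i, abs_nonneg (a i)]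

theorem coord_basis (h : IsMixedBasis e c A B) (i j : ℕ) :
    coord e i (e j) = if j = i then 1 else 0 := by
  have := h.coord_linearCombination i (Finsupp.single j 1)
  rwa [Finsupp.linearCombination_single, one_smul, Finsupp.single_apply] at this

theorem mixedNorm_coord_le (h : IsMixedBasis e c A B) (F : Finset ℕ) (x : X) :
    mixedNorm c F (fun i => coord e i x) ≤ A * ‖x‖ := by
  refine h.denseRange_linearCombination.induction_on
    (p := fun x => mixedNorm c F (fun i => coord e i x) ≤ A * ‖x‖) x ?_ fun a => ?_
  · refine isClosed_le ?_ (by fun_prop)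
    unfold mixedNorm
    fun_prop
  · simp only [h.coord_linearCombination]
    exact h.mixedNorm_finsupp_le F a

theorem sum_abs_coord_le (h : IsMixedBasis e c A B) (x : X) (F : Finset ℕ) :
    ∑ i ∈ F, c i * |coord e i x| ≤ A * ‖x‖ :=
  le_trans (by unfold mixedNorm; linarith [Real.sqrt_nonneg (∑ i ∈ F, coord e i x ^ 2)])
    (h.mixedNorm_coord_le F x)

theorem sqrt_sum_sq_coord_le (h : IsMixedBasis e c A B) (x : X) (F : Finset ℕ) :
    √(∑ i ∈ F, coord e i x ^ 2) ≤ A * ‖x‖ :=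
  le_trans (le_add_of_nonneg_right
    (Finset.sum_nonneg fun i _ => mul_nonneg (h.pos i).le (abs_nonneg _)))
    (h.mixedNorm_coord_le F x)

theorem abs_coord_le (h : IsMixedBasis e c A B) (x : X) (i : ℕ) : |coord e i x| ≤ A * ‖x‖ := by
  simpa [Real.sqrt_sq_eq_abs] using h.sqrt_sum_sq_coord_le x {i}

theorem norm_sum_coord_le (h : IsMixedBasis e c A B) (x : X) (F : Finset ℕ) :
    ‖∑ i ∈ F, coord e i x • e i‖ ≤ B * A * ‖x‖ := by
  rw [mul_assoc]
  exact (h.upper F _).trans (mul_le_mul_of_nonneg_left (h.mixedNorm_coord_le F x) h.B_pos.le)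

/-- The partial sum operators are uniformly bounded by `B * A` and eventually fix each vector of the
dense span. -/
theorem hasSum_coord (h : IsMixedBasis e c A B) (x : X) :
    HasSum (fun i => coord e i x • e i) x := by
  rw [HasSum, SummationFilter.unconditional_filter, Metric.tendsto_atTop]
  intro ε hε
  have hAB : 0 < B * A := mul_pos h.B_pos h.A_pos
  obtain ⟨a, ha⟩ := h.denseRange_linearCombination.exists_dist_lt x
    (show 0 < ε / (B * A + 1) by positivity)
  set y := Finsupp.linearCombination ℝ e a with hy
  refine ⟨a.support, fun F hF => ?_⟩
  have h1 : ∑ i ∈ F, coord e i y • e i = y := by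
    simp only [hy, h.coord_linearCombination]
    rw [Finsupp.linearCombination_apply]
    exact (Finsupp.sum_of_support_subset _ hF (fun i r => r • e i) (by simp)).symm
  have h2 : ∑ i ∈ F, coord e i x • e i - x = ∑ i ∈ F, coord e i (x - y) • e i - (x - y) := by
    simp only [map_sub, sub_smul, Finset.sum_sub_distrib, h1]
    abel
  rw [dist_eq_norm, h2]
  rw [dist_eq_norm, lt_div_iff₀ (by positivity)] at ha
  calc _ ≤ ‖∑ i ∈ F, coord e i (x - y) • e i‖ + ‖x - y‖ := norm_sub_le _ _
    _ ≤ B * A * ‖x - y‖ + ‖x - y‖ := by gcongr; exact h.norm_sum_coord_le _ _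
    _ = ‖x - y‖ * (B * A + 1) := by ring
    _ < ε := ha

/-- On weakly compact sets the weighted `ℓ¹`-tails are uniformly small. -/
theorem exists_uniform_tail (h : IsMixedBasis e c A B) {K : Set X} (hK : IsWeaklyCompact K)
    {ε : ℝ} (hε : 0 < ε) :
    ∃ N : ℕ, ∀ x ∈ K, ∀ F : Finset ℕ, (∀ i ∈ F, N ≤ i) → ∑ i ∈ F, c i * |coord e i x| ≤ ε := by
  have habs : ∀ i x, |(c i • coord e i) x| = c i * |coord e i x| := fun i x => by
    rw [_root_.smul_apply, smul_eq_mul, abs_mul, abs_of_pos (h.pos i)]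
  have := hK.exists_uniform_tail (b := fun i => c i • coord e i) (M := A)
    (fun x F => by simpa only [habs] using h.sum_abs_coord_le x F) hε
  simpa only [habs] using this

/-- A functional splits into a part in `ℓ²` and a part dominated by the weights. -/
theorem exists_dual_bound (h : IsMixedBasis e c A B) (φ : X →L[ℝ] ℝ) :
    ∃ M : ℝ, 0 < M ∧ ∀ F : Finset ℕ, (∀ i ∈ F, M * c i < |φ (e i)|) →
      ∑ i ∈ F, φ (e i) ^ 2 ≤ M ^ 2 := by
  -- Testing `φ` on `∑ φ(eᵢ) eᵢ` gives `s ≤ (M / 2)(√s + T)`, and the choice of `F` gives `M T ≤ s`;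
  -- hence `s ≤ M √s`.
  set M : ℝ := 2 * B * (‖φ‖ + 1) with hM
  have hB := h.B_pos
  have hφ := norm_nonneg φ
  have hM0 : 0 < M := by positivity
  refine ⟨M, hM0, fun F hF => ?_⟩
  set s : ℝ := ∑ i ∈ F, φ (e i) ^ 2 with hs
  have hs0 : 0 ≤ s := Finset.sum_nonneg fun i _ => sq_nonneg _
  have h1 : s ≤ ‖φ‖ * (B * mixedNorm c F fun i => φ (e i)) := by
    calc s = φ (∑ i ∈ F, φ (e i) • e i) := by simp [hs, map_sum, sq]
      _ ≤ ‖φ (∑ i ∈ F, φ (e i) • e i)‖ := Real.le_norm_self _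
      _ ≤ ‖φ‖ * ‖∑ i ∈ F, φ (e i) • e i‖ := φ.le_opNorm _
      _ ≤ _ := by gcongr; exact h.upper F _
  have h2 : M * ∑ i ∈ F, c i * |φ (e i)| ≤ s := by
    rw [Finset.mul_sum]
    refine Finset.sum_le_sum fun i hi => ?_
    have := mul_le_mul_of_nonneg_right (hF i hi).le (abs_nonneg (φ (e i)))
    rw [← sq_abs (φ (e i)), sq]
    linarith
  set T := ∑ i ∈ F, c i * |φ (e i)| with hT
  have hT0 : 0 ≤ T := Finset.sum_nonneg fun i _ => mul_nonneg (h.pos i).le (abs_nonneg _)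
  have hq := Real.sq_sqrt hs0
  have hq0 := Real.sqrt_nonneg s
  have h3 : s ≤ M / 2 * (√s + T) := by
    refine h1.trans ?_
    rw [show ‖φ‖ * (B * mixedNorm c F fun i => φ (e i)) = ‖φ‖ * B * (√s + T) by
      simp only [mixedNorm, hs, hT]; ring]
    refine mul_le_mul_of_nonneg_right ?_ (by positivity)
    rw [hM]; nlinarith
  have h4 : √s ≤ M := by
    by_contra! hlt
    nlinarith
  rw [← hq]
  gcongr

/-- Where `|φ(eᵢ)|` exceeds `M cᵢ` the values are square summable and Cauchy–Schwarz applies;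
elsewhere the weights dominate. `M` does not depend on `ε`, so the weighted tail can be made small
afterwards. -/
theorem exists_dual_tail (h : IsMixedBasis e c A B) (φ : X →L[ℝ] ℝ) :
    ∃ M : ℝ, 0 < M ∧ ∀ ε : ℝ, 0 < ε → ∃ N : ℕ, ∀ F : Finset ℕ, (∀ i ∈ F, N ≤ i) →
      ∀ a : ℕ → ℝ, |∑ i ∈ F, a i * φ (e i)| ≤
        ε * √(∑ i ∈ F, a i ^ 2) + M * ∑ i ∈ F, c i * |a i| := by
  classical
  obtain ⟨M, hM, hb⟩ := h.exists_dual_bound φ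
  refine ⟨M, hM, fun ε hε => ?_⟩
  let t : ℕ → ℝ := fun i => if M * c i < |φ (e i)| then φ (e i) ^ 2 else 0
  have ht0 : ∀ i, 0 ≤ t i := fun i => by simp only [t]; split_ifs <;> positivity
  have habs : ∀ i, |t i| = t i := fun i => abs_of_nonneg (ht0 i)
  have hsum : Summable fun i => |t i| := by
    refine summable_abs_of_sum_le (M := M ^ 2) fun F => ?_
    simp only [habs, t, ← Finset.sum_filter]
    exact hb _ fun i hi => (Finset.mem_filter.mp hi).2
  obtain ⟨N, hN⟩ := exists_forall_sum_abs_le hsum (show 0 < ε ^ 2 by positivity)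
  refine ⟨N, fun F hF a => ?_⟩
  have hsqrt : √(∑ i ∈ F, t i) ≤ ε := by
    rw [Real.sqrt_le_left hε.le]
    have := hN F hF
    simp only [habs] at this
    exact this.le
  have hi : ∀ i, |a i * φ (e i)| ≤ |a i| * √(t i) + M * (c i * |a i|) := fun i => by
    rw [abs_mul]
    have hc := h.pos i
    simp only [t]
    split_ifs with hlt
    · rw [Real.sqrt_sq_eq_abs]
      have : 0 ≤ M * (c i * |a i|) := by positivity
      linarith
    · rw [Real.sqrt_zero, mul_zero, zero_add]
      have := mul_le_mul_of_nonneg_left (not_lt.mp hlt) (abs_nonneg (a i))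
      linarith
  calc |∑ i ∈ F, a i * φ (e i)| ≤ ∑ i ∈ F, |a i * φ (e i)| := Finset.abs_sum_le_sum_abs _ _
    _ ≤ ∑ i ∈ F, (|a i| * √(t i) + M * (c i * |a i|)) := Finset.sum_le_sum fun i _ => hi i
    _ = ∑ i ∈ F, |a i| * √(t i) + M * ∑ i ∈ F, c i * |a i| := by
      rw [Finset.sum_add_distrib, Finset.mul_sum]
    _ ≤ √(∑ i ∈ F, |a i| ^ 2) * √(∑ i ∈ F, √(t i) ^ 2) + M * ∑ i ∈ F, c i * |a i| := by
      gcongr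
      exact Real.sum_mul_le_sqrt_mul_sqrt _ _ _
    _ ≤ ε * √(∑ i ∈ F, a i ^ 2) + M * ∑ i ∈ F, c i * |a i| := by
      simp only [sq_abs, Real.sq_sqrt (ht0 _)]
      rw [mul_comm]
      gcongr

/-! ### Reduction of `AK` to `ω^ω` -/

/-- Coefficient sequences bounded in `ℓ²`, with prescribed bounds for the weighted `ℓ¹`-tails. -/
def tailSet (c : ℕ → ℝ) (R : ℝ) (ψ : ℕ → ℕ) : Set (ℕ → ℝ) :=
  {a | (∀ F : Finset ℕ, √(∑ i ∈ F, a i ^ 2) ≤ R) ∧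
    ∀ k : ℕ, ∀ F : Finset ℕ, (∀ i ∈ F, ψ k ≤ i) → ∑ i ∈ F, c i * |a i| ≤ (1 / 2) ^ k}

/-- Each condition involves finitely many coordinates, so the set is closed in a Tychonoff cube. -/
theorem isCompact_tailSet (c : ℕ → ℝ) (R : ℝ) (ψ : ℕ → ℕ) : IsCompact (tailSet c R ψ) := by
  refine IsCompact.of_isClosed_subset
    (isCompact_univ_pi fun _ : ℕ => isCompact_Icc (a := -R) (b := R)) ?_ ?_
  · simp only [tailSet, Set.ofPred_and, Set.ofPred_forall]
    refine IsClosed.inter (isClosed_iInter fun F => isClosed_le (by fun_prop) (by fun_prop)) ?_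
    exact isClosed_iInter fun k => isClosed_iInter fun F => isClosed_iInter fun _ =>
      isClosed_le (by fun_prop) (by fun_prop)
  · intro a ha i _
    have := ha.1 {i}
    rw [Finset.sum_singleton, Real.sqrt_sq_eq_abs, abs_le] at this
    exact this

theorem summable_of_mem_tailSet [CompleteSpace X] (h : IsMixedBasis e c A B) {R : ℝ} {ψ : ℕ → ℕ}
    {a : ℕ → ℝ} (ha : a ∈ tailSet c R ψ) : Summable fun i => a i • e i := by
  have hR : 0 ≤ R := (Real.sqrt_nonneg _).trans (ha.1 ∅)
  have hsq : Summable fun i => |a i ^ 2| := by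
    refine summable_abs_of_sum_le (M := R ^ 2) fun F => ?_
    simp only [abs_of_nonneg (sq_nonneg (_ : ℝ))]
    exact (Real.sqrt_le_left hR).mp (ha.1 F)
  have hB := h.B_pos
  rw [summable_iff_vanishing_norm]
  intro ε hε
  obtain ⟨k, hk⟩ := exists_pow_lt_of_lt_one (show 0 < ε / (2 * B) by positivity)
    (show (1 / 2 : ℝ) < 1 by norm_num)
  obtain ⟨N, hN⟩ := exists_forall_sum_abs_le hsq (show 0 < (ε / (2 * B)) ^ 2 by positivity)
  refine ⟨Finset.range (max N (ψ k)), fun F hF => ?_⟩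
  have hF' : ∀ i ∈ F, max N (ψ k) ≤ i := fun i hi => by
    have := Finset.disjoint_left.mp hF hi
    simpa using this
  have h1 : √(∑ i ∈ F, a i ^ 2) ≤ ε / (2 * B) := by
    rw [Real.sqrt_le_left (by positivity)]
    have := hN F fun i hi => (le_max_left _ _).trans (hF' i hi)
    simp only [abs_of_nonneg (sq_nonneg (_ : ℝ))] at this
    exact this.le
  have h2 := ha.2 k F fun i hi => (le_max_right _ _).trans (hF' i hi)
  calc ‖∑ i ∈ F, a i • e i‖ ≤ B * mixedNorm c F a := h.upper F a
    _ < B * (ε / (2 * B) + ε / (2 * B)) := by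
      refine mul_lt_mul_of_pos_left ?_ hB
      unfold mixedNorm
      linarith
    _ = ε := by field_simp; ring

/-- By `exists_dual_tail`, the partial sums of any functional converge uniformly on `tailSet`, so
summation is continuous from the product topology to the weak one. -/
theorem isWeaklyCompact_image_tailSet [CompleteSpace X] (h : IsMixedBasis e c A B) (R : ℝ)
    (ψ : ℕ → ℕ) : IsWeaklyCompact ((fun a : ℕ → ℝ => ∑' i, a i • e i) '' tailSet c R ψ) := by
  refine IsWeaklyCompact.image_of_continuousOn (isCompact_tailSet c R ψ) _ fun φ => ?_
  rcases lt_or_ge R 0 with hR | hR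
  · have : tailSet c R ψ = ∅ := Set.eq_empty_of_forall_notMem fun a ha =>
      absurd ((Real.sqrt_nonneg _).trans (ha.1 ∅)) (not_le.mpr hR)
    rw [this]; exact continuousOn_empty _
  obtain ⟨M, hM, htail⟩ := h.exists_dual_tail φ
  have hsum : ∀ a ∈ tailSet c R ψ, HasSum (fun i => a i * φ (e i)) (φ (∑' i, a i • e i)) := by
    intro a ha
    have := (h.summable_of_mem_tailSet ha).hasSum.mapL φ
    simpa using this
  have hunif : TendstoUniformlyOn (fun n (a : ℕ → ℝ) => ∑ i ∈ Finset.range n, a i * φ (e i))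
      (fun a => φ (∑' i, a i • e i)) atTop (tailSet c R ψ) := by
    rw [Metric.tendstoUniformlyOn_iff]
    intro ε hε
    obtain ⟨k, hk⟩ := exists_pow_lt_of_lt_one (show 0 < ε / (4 * M) by positivity)
      (show (1 / 2 : ℝ) < 1 by norm_num)
    obtain ⟨N, hN⟩ := htail (ε / (4 * (R + 1))) (by positivity)
    filter_upwards [eventually_ge_atTop (max N (ψ k))] with n hn a ha
    have hlim := ((hsum a ha).tendsto_sum_nat.sub_const
      (∑ i ∈ Finset.range n, a i * φ (e i))).abs
    have hle : |φ (∑' i, a i • e i) - ∑ i ∈ Finset.range n, a i * φ (e i)| ≤ ε / 2 := by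
      refine le_of_tendsto hlim ?_
      filter_upwards [eventually_ge_atTop n] with m hm
      rw [← Finset.sum_Ico_eq_sub _ hm]
      have hF : ∀ i ∈ Finset.Ico n m, max N (ψ k) ≤ i := fun i hi =>
        hn.trans (Finset.mem_Ico.mp hi).1
      have h1 := hN (Finset.Ico n m) (fun i hi => (le_max_left _ _).trans (hF i hi)) a
      have h2 := ha.2 k (Finset.Ico n m) fun i hi => (le_max_right _ _).trans (hF i hi)
      have h3 := ha.1 (Finset.Ico n m)
      have h4 : ε / (4 * (R + 1)) * √(∑ i ∈ Finset.Ico n m, a i ^ 2) ≤ ε / 4 := by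
        calc _ ≤ ε / (4 * (R + 1)) * (R + 1) := by gcongr; linarith
          _ = ε / 4 := by field_simp
      have h5 : M * ∑ i ∈ Finset.Ico n m, c i * |a i| ≤ ε / 4 := by
        calc _ ≤ M * (ε / (4 * M)) := by gcongr; linarith
          _ = ε / 4 := by field_simp
      linarith
    rw [Real.dist_eq]
    linarith
  refine hunif.continuousOn (Frequently.of_forall fun n => ?_)
  exact Continuous.continuousOn (by fun_prop)

/-- The weakly compact subsets of the ball are Tukey below `ω^ω`. -/
theorem AK_tukeyReducible [CompleteSpace X] (h : IsMixedBasis e c A B) :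
    (AK (Metric.closedBall (0 : X) 1)).TukeyReducible (AsymptoticStructure.ofPoset (ℕ → ℕ)) := by
  have hK : ∀ K : {K : Set X // K ⊆ Metric.closedBall (0 : X) 1 ∧ IsWeaklyCompact K}, ∀ k : ℕ,
      ∃ N : ℕ, ∀ x ∈ (K : Set X), ∀ F : Finset ℕ, (∀ i ∈ F, N ≤ i) →
        ∑ i ∈ F, c i * |coord e i x| ≤ (1 / 2 : ℝ) ^ k := fun K k =>
    h.exists_uniform_tail K.2.2 (by positivity)
  choose f hf using hK
  refine ⟨fun _ K => f K, fun ε hε => ⟨1, one_pos, fun ψ => ?_⟩⟩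
  -- The `ℓ²` radius is `A` because `‖x‖ ≤ 1` on `K`. The inclusion obtained is exact, so neither
  -- `ε` nor `δ` plays a role.
  refine ⟨⟨((fun a : ℕ → ℝ => ∑' i, a i • e i) '' tailSet c A ψ) ∩ Metric.closedBall (0 : X) 1,
    Set.inter_subset_right, (h.isWeaklyCompact_image_tailSet A ψ).inter_closed_convex
      Metric.isClosed_closedBall (convex_closedBall _ _)⟩, fun K hKψ x hx => ?_⟩
  refine ⟨x, ⟨⟨fun i => coord e i x, ⟨fun F => ?_, fun k F hF => ?_⟩, (h.hasSum_coord x).tsum_eq⟩,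
    K.2.1 hx⟩, 0, ⟨0, by simp, by simp⟩, by simp⟩
  · have hx1 : ‖x‖ ≤ 1 := by simpa using K.2.1 hx
    exact (h.sqrt_sum_sq_coord_le x F).trans (mul_le_of_le_one_right h.A_pos.le hx1)
  · exact hf K k x hx F fun i hi => (hKψ k).trans (hF i hi)

/-! ### Reduction of `ω^ω` to `AK`, and failure of SWCG -/

/-- The set consisting of `0` and of a multiple of one basis vector from each row. -/
def selection (e : ℕ → X) (θ : ℝ) (φ : ℕ → ℕ) : Set X :=
  insert 0 (Set.range fun n => θ • e (Nat.pair n (φ n)))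

/-- On a single basis vector the dual tail bound reads `ε + M w n`; since `n ≤ Nat.pair n m`, it
applies to all late rows. -/
theorem isWeaklyCompact_selection (h : IsMixedBasis e c A B) {w : ℕ → ℝ}
    (hw : Tendsto w atTop (𝓝 0)) (hcw : ∀ n m, c (Nat.pair n m) = w n) (θ : ℝ) (φ : ℕ → ℕ) :
    IsWeaklyCompact (selection e θ φ) := by
  refine isWeaklyCompact_insert_zero_range fun y => ?_
  suffices hmain : Tendsto (fun n => y (e (Nat.pair n (φ n)))) atTop (𝓝 0) by
    simpa using hmain.const_mul θ
  obtain ⟨M, hM, htail⟩ := h.exists_dual_tail y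
  rw [Metric.tendsto_atTop']
  intro ε hε
  obtain ⟨N, hN⟩ := htail (ε / 2) (by positivity)
  obtain ⟨N', hN'⟩ := Metric.tendsto_atTop'.mp hw (ε / (2 * M)) (by positivity)
  refine ⟨max N N', fun n hn => ?_⟩
  have h1 := hN {Nat.pair n (φ n)} (by
    simp only [Finset.mem_singleton, forall_eq]
    exact ((le_max_left _ _).trans hn.le).trans (Nat.left_le_pair _ _)) fun _ => 1
  have h2 := hN' n ((le_max_right _ _).trans_lt hn)
  simp only [Finset.sum_singleton, one_mul, one_pow, Real.sqrt_one, mul_one, abs_one, hcw] at h1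
  rw [dist_zero_right, Real.norm_eq_abs] at h2 ⊢
  have h3 : M * w n < M * (ε / (2 * M)) :=
    mul_lt_mul_of_pos_left ((le_abs_self _).trans_lt h2) hM
  have h4 : M * (ε / (2 * M)) = ε / 2 := by field_simp
  linarith

/-- A weakly compact set, fattened a little, contains only finitely many vectors of each row. -/
theorem exists_selection_bound (h : IsMixedBasis e c A B) {w : ℕ → ℝ}
    (hcw : ∀ n m, c (Nat.pair n m) = w n) {θ : ℝ} (hθ : 0 < θ) {K : Set X}
    (hK : IsWeaklyCompact K) :
    ∃ ψ : ℕ → ℕ, ∀ φ : ℕ → ℕ,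
      selection e θ φ ⊆ K + (θ / (2 * A)) • Metric.closedBall (0 : X) 1 → φ ≤ ψ := by
  have hA := h.A_pos
  have hw : ∀ n, 0 < w n := fun n => hcw n 0 ▸ h.pos _
  -- The tolerance is scaled by the row weight, so beyond column `ψ n` the coordinates in row `n`
  -- are at most `θ / 4`. The fattening adds at most `θ / 2`, short of the required `θ`.
  have := fun n => h.exists_uniform_tail hK (show 0 < w n * (θ / 4) by have := hw n; positivity)
  choose ψ hψ using this
  refine ⟨ψ, fun φ hφ n => ?_⟩
  by_contra! hlt
  obtain ⟨x, hx, z, ⟨v, hv, rfl⟩, hxz⟩ := hφ (Set.mem_insert_of_mem _ ⟨n, rfl⟩)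
  set i := Nat.pair n (φ n) with hi
  have h1 := hψ n x hx {i} (by
    simp only [Finset.mem_singleton, forall_eq]
    exact hlt.le.trans (Nat.right_le_pair _ _))
  rw [Finset.sum_singleton, hcw] at h1
  have h2 : |coord e i x| ≤ θ / 4 := le_of_mul_le_mul_left h1 (hw n)
  have h3 : coord e i x + θ / (2 * A) * coord e i v = θ := by
    have := congrArg (coord e i) hxz
    simpa [h.coord_basis, hi] using this
  have hv1 : ‖v‖ ≤ 1 := by simpa using hv
  have h4 : |coord e i v| ≤ A := (h.abs_coord_le v i).trans (mul_le_of_le_one_right hA.le hv1)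
  have h5 : θ / (2 * A) * coord e i v ≤ θ / 2 := by
    calc _ ≤ θ / (2 * A) * A := by gcongr; exact (le_abs_self _).trans h4
      _ = θ / 2 := by field_simp
  linarith [le_abs_self (coord e i x)]

theorem exists_selection_subset_ball (h : IsMixedBasis e c A B) {w : ℕ → ℝ}
    (hw : Tendsto w atTop (𝓝 0)) (hcw : ∀ n m, c (Nat.pair n m) = w n) :
    ∃ θ : ℝ, 0 < θ ∧ ∀ φ, selection e θ φ ⊆ Metric.closedBall (0 : X) 1 := by
  obtain ⟨M, hM⟩ := hw.bddAbove_range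
  have hB := h.B_pos
  have hM0 : 0 < M := (h.pos _).trans_le ((hcw 0 0).le.trans (hM ⟨0, rfl⟩))
  refine ⟨1 / (B * (1 + M)), by positivity, fun φ => Set.insert_subset (by simp) ?_⟩
  rintro _ ⟨n, rfl⟩
  have h1 := h.upper {Nat.pair n (φ n)} fun _ => 1
  simp only [mixedNorm, Finset.sum_singleton, one_pow, Real.sqrt_one, abs_one, mul_one, one_smul,
    hcw] at h1
  have h2 : w n ≤ M := hM ⟨n, rfl⟩
  simp only [Metric.mem_closedBall, dist_zero_right, norm_smul]
  rw [Real.norm_of_nonneg (by positivity), one_div, inv_mul_le_one₀ (by positivity)]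
  exact h1.trans (by gcongr)

/-- `ω^ω` is Tukey below the weakly compact subsets of the ball. -/
theorem tukeyReducible_AK (h : IsMixedBasis e c A B) {w : ℕ → ℝ}
    (hw : Tendsto w atTop (𝓝 0)) (hcw : ∀ n m, c (Nat.pair n m) = w n) :
    (AsymptoticStructure.ofPoset (ℕ → ℕ)).TukeyReducible (AK (Metric.closedBall (0 : X) 1)) := by
  have hA := h.A_pos
  obtain ⟨θ, hθ, hball⟩ := h.exists_selection_subset_ball hw hcw
  refine ⟨fun _ φ => ⟨selection e θ φ, hball φ, h.isWeaklyCompact_selection hw hcw θ φ⟩,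
    fun ε _ => ⟨θ / (2 * A), by positivity, fun K => ?_⟩⟩
  exact h.exists_selection_bound hcw hθ K.2.2

/-- Each multiple `jK` yields a bound `ψ j`; the diagonal selection `n ↦ ψ n n + 1` escapes all of
them. -/
theorem not_isSWCG (h : IsMixedBasis e c A B) {w : ℕ → ℝ}
    (hw : Tendsto w atTop (𝓝 0)) (hcw : ∀ n m, c (Nat.pair n m) = w n) : ¬ IsSWCG X := by
  rintro ⟨K, hK, hgen⟩
  have hA := h.A_pos
  have hbound : ∀ j : ℕ, ∃ ψ : ℕ → ℕ, ∀ φ : ℕ → ℕ,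
      selection e 1 φ ⊆ (j : ℝ) • K + (1 / (2 * A)) • Metric.closedBall (0 : X) 1 → φ ≤ ψ :=
    fun j => h.exists_selection_bound hcw one_pos
      (hK.image ((j : ℝ) • ContinuousLinearMap.id ℝ X))
  choose ψ hψ using hbound
  obtain ⟨j, hj⟩ := hgen (1 / (2 * A)) (by positivity) _
    (h.isWeaklyCompact_selection hw hcw 1 fun n => ψ n n + 1)
  have := hψ j _ hj j
  simp at this

end IsMixedBasis

end MixedBasis

/-! ### `L¹`-norms of sums of independent variables -/

section IndependentSums

variable {Ω : Type*} [MeasurableSpace Ω] {μ : Measure Ω}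

/-- Adding an independent mean zero variable does not decrease the `L¹`-norm. -/
theorem ProbabilityTheory.IndepFun.integral_abs_le_integral_abs_add [IsProbabilityMeasure μ]
    {X Z : Ω → ℝ} (h : IndepFun X Z μ) (hX : Integrable X μ) (hZ : Integrable Z μ)
    (hZ0 : ∫ ω, Z ω ∂μ = 0) :
    ∫ ω, |X ω| ∂μ ≤ ∫ ω, |X ω + Z ω| ∂μ := by
  have hXm := hX.aemeasurable
  have hZm := hZ.aemeasurable
  have := Measure.isProbabilityMeasure_map hXm
  have := Measure.isProbabilityMeasure_map hZm
  have hprod : μ.map (fun ω => (X ω, Z ω)) = (μ.map X).prod (μ.map Z) :=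
    h.map_prod_eq_prod_map_map hXm hZm
  have hint : Integrable (fun q : ℝ × ℝ => |q.1 + q.2|) ((μ.map X).prod (μ.map Z)) := by
    rw [← hprod, integrable_map_measure (by fun_prop) (hXm.prodMk hZm)]
    exact (hX.add hZ).abs
  have hZi : Integrable (fun z : ℝ => z) (μ.map Z) :=
    (integrable_map_measure aestronglyMeasurable_id hZm).mpr hZ
  have h1 : ∫ ω, |X ω + Z ω| ∂μ = ∫ x, ∫ z, |x + z| ∂(μ.map Z) ∂(μ.map X) := by
    rw [← integral_prod _ hint, ← hprod,
      integral_map (hXm.prodMk hZm) (by fun_prop)]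
  have h2 : ∫ ω, |X ω| ∂μ = ∫ x, |x| ∂(μ.map X) := (integral_map hXm (by fun_prop)).symm
  rw [h1, h2]
  refine integral_mono ?_ hint.integral_prod_left fun x => ?_
  · exact (integrable_map_measure (by fun_prop) hXm).mpr hX.abs
  -- After Fubini `x` is fixed, and `|x|` is the modulus of the mean of `x + Z`.
  · have h3 : ∫ z, (x + z) ∂(μ.map Z) = x := by
      rw [integral_add (integrable_const _) hZi, integral_const,
        integral_map hZm (by fun_prop), hZ0]
      simp
    calc |x| = |∫ z, (x + z) ∂(μ.map Z)| := by rw [h3]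
      _ ≤ ∫ z, |x + z| ∂(μ.map Z) := abs_integral_le_integral_abs

/-- Partial sums of independent mean zero variables have smaller `L¹`-norm. -/
theorem ProbabilityTheory.iIndepFun.integral_abs_sum_le {ι : Type*} {ξ : ι → Ω → ℝ}
    (h : iIndepFun ξ μ) (hm : ∀ i, Measurable (ξ i)) (hi : ∀ i, Integrable (ξ i) μ)
    (h0 : ∀ i, ∫ ω, ξ i ω ∂μ = 0)
    {G F : Finset ι} (hGF : G ⊆ F) :
    ∫ ω, |∑ i ∈ G, ξ i ω| ∂μ ≤ ∫ ω, |∑ i ∈ F, ξ i ω| ∂μ := by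
  classical
  have := h.isProbabilityMeasure
  have hind := h.indepFun_finset G (F \ G) Finset.disjoint_sdiff hm
  have hind' := hind.comp (φ := fun v : G → ℝ => ∑ i, v i)
    (ψ := fun v : ↥(F \ G) → ℝ => ∑ i, v i) (by fun_prop) (by fun_prop)
  have e1 : (fun v : G → ℝ => ∑ i, v i) ∘ (fun a (i : G) => ξ i a) = fun ω => ∑ i ∈ G, ξ i ω := by
    ext ω; exact Finset.sum_coe_sort G fun i => ξ i ω
  have e2 : (fun v : ↥(F \ G) → ℝ => ∑ i, v i) ∘ (fun a (i : ↥(F \ G)) => ξ i a) =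
      fun ω => ∑ i ∈ F \ G, ξ i ω := by
    ext ω; exact Finset.sum_coe_sort (F \ G) fun i => ξ i ω
  rw [e1, e2] at hind'
  have := hind'.integral_abs_le_integral_abs_add (integrable_finsetSum _ fun i _ => hi i)
    (integrable_finsetSum _ fun i _ => hi i)
    (by rw [integral_finsetSum _ fun i _ => hi i]; exact Finset.sum_eq_zero fun i _ => h0 i)
  refine this.trans_eq ?_
  congr 1; ext ω
  rw [add_comm, Finset.sum_sdiff hGF]

theorem ProbabilityTheory.iIndepFun.indepFun_fun_sum {ι : Type*} {ξ : ι → Ω → ℝ}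
    (h : iIndepFun ξ μ) (hm : ∀ i, Measurable (ξ i)) {F : Finset ι} {i : ι} (hi : i ∉ F) :
    IndepFun (fun ω => ∑ j ∈ F, ξ j ω) (ξ i) μ := by
  have := h.indepFun_finsetSum_of_notMem hm hi
  convert this using 1
  ext ω; simp

theorem ProbabilityTheory.iIndepFun.const_mul {ι : Type*} {ξ : ι → Ω → ℝ} (h : iIndepFun ξ μ)
    (a : ι → ℝ) : iIndepFun (fun i ω => a i * ξ i ω) μ :=
  h.comp (fun i x => a i * x) fun i => by fun_prop

/-- Linear combinations of independent standard Gaussian variables. -/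
theorem integral_abs_sum_gaussian {ι : Type*} {r : ι → Ω → ℝ} (h : iIndepFun r μ)
    (hm : ∀ i, Measurable (r i)) (hr : ∀ i, μ.map (r i) = gaussianReal 0 1) (F : Finset ι)
    (a : ι → ℝ) :
    ∫ ω, |∑ i ∈ F, a i * r i ω| ∂μ = √(∑ i ∈ F, a i ^ 2) * ∫ x, |x| ∂(gaussianReal 0 1) := by
  classical
  have := h.isProbabilityMeasure
  have hmap : ∀ s : ℝ, (gaussianReal 0 1).map (s * ·) = gaussianReal 0 (s ^ 2).toNNReal :=
      fun s => by
    rw [gaussianReal_map_const_mul, mul_zero, mul_one]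
    congr 1
    ext; simp [sq_nonneg]
  have hlaw : μ.map (fun ω => ∑ i ∈ F, a i * r i ω) =
      gaussianReal 0 (∑ i ∈ F, a i ^ 2).toNNReal := by
    induction F using Finset.induction_on with
    | empty => simp
    | insert i F hi ih =>
      have hind : IndepFun (fun ω => a i * r i ω) (fun ω => ∑ j ∈ F, a j * r j ω) μ :=
        ((h.const_mul a).indepFun_fun_sum (fun i => by have := hm i; fun_prop) hi).symm
      have h1 : μ.map (fun ω => a i * r i ω) = gaussianReal 0 (a i ^ 2).toNNReal := by
        rw [← hmap, ← hr i, Measure.map_map (by fun_prop) (hm i)]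
        rfl
      have h2 := gaussianReal_add_gaussianReal_of_indepFun hind h1 ih
      simp only [Finset.sum_insert hi]
      rw [Real.toNNReal_add (sq_nonneg _) (Finset.sum_nonneg fun _ _ => sq_nonneg _)]
      rw [add_zero] at h2
      exact h2
  -- The sum has the law of `√(∑ aᵢ²)` times one standard Gaussian.
  have hs : (∑ i ∈ F, a i ^ 2) = √(∑ i ∈ F, a i ^ 2) ^ 2 :=
    (Real.sq_sqrt (Finset.sum_nonneg fun _ _ => sq_nonneg _)).symm
  have hmeas : Measurable fun ω => ∑ i ∈ F, a i * r i ω :=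
    Finset.measurable_sum _ fun i _ => (hm i).const_mul _
  rw [← integral_map (φ := fun ω => ∑ i ∈ F, a i * r i ω) (f := fun x : ℝ => |x|)
    hmeas.aemeasurable (by fun_prop), hlaw, hs, ← hmap, integral_map (by fun_prop) (by fun_prop),
    ← hs, ← integral_const_mul]
  congr 1; ext x
  rw [abs_mul, abs_of_nonneg (Real.sqrt_nonneg _)]

theorem integral_abs_gaussianReal_pos : 0 < ∫ x, |x| ∂(gaussianReal 0 1) := by
  have hint : Integrable (fun x : ℝ => |x|) (gaussianReal 0 1) :=
    ((memLp_id_gaussianReal' 1 (by simp)).integrable le_rfl).abs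
  rw [integral_pos_iff_support_of_nonneg (fun x => abs_nonneg x) hint]
  have hsupp : Function.support (fun x : ℝ => |x|) = {0}ᶜ := by ext x; simp
  have := nullSingletonClass_gaussianReal (μ := 0) (v := 1) one_ne_zero
  rw [hsupp, prob_compl_eq_one_sub (measurableSet_singleton 0), measure_singleton]
  simp

/-- A variable concentrated on a set of small measure is almost disjoint from an independent one. -/
theorem ProbabilityTheory.IndepFun.le_integral_abs_add [IsProbabilityMeasure μ]
    {X Z : Ω → ℝ} (h : IndepFun X Z μ)
    (hX : Integrable X μ) (hZ : Integrable Z μ) (hZm : Measurable Z) :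
    (∫ ω, |X ω| ∂μ) + (∫ ω, |Z ω| ∂μ) - 2 * (μ.real {ω | Z ω ≠ 0} * ∫ ω, |X ω| ∂μ) ≤
      ∫ ω, |X ω + Z ω| ∂μ := by
  have hS : MeasurableSet {x : ℝ | x ≠ 0} := (measurableSet_singleton 0).compl
  have hind : IndepFun (fun ω => |X ω|)
      (fun ω => Set.indicator {x : ℝ | x ≠ 0} (fun _ => (1 : ℝ)) (Z ω)) μ :=
    h.comp (φ := fun x => |x|) (ψ := Set.indicator {x : ℝ | x ≠ 0} fun _ => (1 : ℝ)) (by fun_prop)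
      (measurable_const.indicator hS)
  have hIm : Measurable fun ω => Set.indicator {x : ℝ | x ≠ 0} (fun _ => (1 : ℝ)) (Z ω) :=
    (measurable_const.indicator hS).comp hZm
  have hprod : ∫ ω, |X ω| * Set.indicator {x : ℝ | x ≠ 0} (fun _ => (1 : ℝ)) (Z ω) ∂μ =
      (∫ ω, |X ω| ∂μ) * μ.real {ω | Z ω ≠ 0} := by
    rw [hind.integral_fun_mul_eq_mul_integral hX.abs.aestronglyMeasurable
      hIm.aestronglyMeasurable]
    congr 1
    have : (fun ω => Set.indicator {x : ℝ | x ≠ 0} (fun _ => (1 : ℝ)) (Z ω)) =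
        Set.indicator {ω | Z ω ≠ 0} 1 := by
      ext ω; simp [Set.indicator_apply]
    rw [this]
    exact integral_indicator_one (hZm hS)
  have hI : Integrable
      (fun ω => |X ω| * Set.indicator {x : ℝ | x ≠ 0} (fun _ => (1 : ℝ)) (Z ω)) μ := by
    refine Integrable.mono' hX.abs (hX.abs.aestronglyMeasurable.mul hIm.aestronglyMeasurable)
      (Eventually.of_forall fun ω => ?_)
    by_cases hz : Z ω = 0 <;> simp [hz]
  -- Pointwise, `|X + Z| ≥ |X| + |Z| - 2|X|` where `Z ≠ 0`, with equality to `|X|` elsewhere; the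
  -- correction integrates to a product by independence.
  have key : ∫ ω, (|X ω| + |Z ω| -
      2 * (|X ω| * Set.indicator {x : ℝ | x ≠ 0} (fun _ => (1 : ℝ)) (Z ω))) ∂μ ≤
      ∫ ω, |X ω + Z ω| ∂μ := by
    refine integral_mono ((hX.abs.add hZ.abs).sub (hI.const_mul 2)) (hX.add hZ).abs fun ω => ?_
    by_cases hz : Z ω = 0
    · simp [hz]
    · simp only [Set.indicator_apply, Set.mem_ofPred_eq, ne_eq, hz, not_false_eq_true, if_true]
      have := abs_sub_abs_le_abs_sub (Z ω) (-X ω)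
      rw [abs_neg, sub_neg_eq_add, add_comm (Z ω)] at this
      linarith
  have hsplit : ∫ ω, (|X ω| + |Z ω| -
      2 * (|X ω| * Set.indicator {x : ℝ | x ≠ 0} (fun _ => (1 : ℝ)) (Z ω))) ∂μ =
      (∫ ω, |X ω| ∂μ) + (∫ ω, |Z ω| ∂μ) - 2 * ((∫ ω, |X ω| ∂μ) * μ.real {ω | Z ω ≠ 0}) := by
    rw [← hprod, ← integral_const_mul, ← integral_add hX.abs hZ.abs]
    exact integral_sub (hX.abs.add hZ.abs) (hI.const_mul 2)
  rw [hsplit] at key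
  linarith

/-- Independent variables concentrated on sets of small measure behave as the `ℓ¹`-basis. -/
theorem le_integral_abs_sum_of_small_support {ι : Type*} {g : ι → Ω → ℝ} (h : iIndepFun g μ)
    (hm : ∀ i, Measurable (g i)) (hi : ∀ i, Integrable (g i) μ) (h1 : ∀ i, ∫ ω, |g i ω| ∂μ = 1)
    (F : Finset ι) (s : ι → ℝ) :
    (1 - 2 * ∑ i ∈ F, μ.real {ω | g i ω ≠ 0}) * ∑ i ∈ F, |s i| ≤
      ∫ ω, |∑ i ∈ F, s i * g i ω| ∂μ := by
  classical
  have := h.isProbabilityMeasure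
  induction F using Finset.induction_on with
  | empty => simp
  | insert i F hiF ih =>
    have hint : Integrable (fun ω => ∑ j ∈ F, s j * g j ω) μ :=
      integrable_finsetSum _ fun j _ => (hi j).const_mul _
    -- The new term costs twice its support measure times the norm of the old sum, which is at most
    -- `∑ |sⱼ|`.
    have h2 := ((h.const_mul s).indepFun_fun_sum (fun i => by have := hm i; fun_prop)
      hiF).le_integral_abs_add hint ((hi i).const_mul _) ((hm i).const_mul _)
    have h3 : ∫ ω, |∑ j ∈ F, s j * g j ω| ∂μ ≤ ∑ j ∈ F, |s j| := by
      calc _ ≤ ∫ ω, ∑ j ∈ F, |s j| * |g j ω| ∂μ := by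
            refine integral_mono hint.abs
              (integrable_finsetSum _ fun j _ => (hi j).abs.const_mul _) fun ω => ?_
            simp only [← abs_mul]
            exact Finset.abs_sum_le_sum_abs _ _
        _ = ∑ j ∈ F, |s j| := by
            rw [integral_finsetSum _ fun j _ => (hi j).abs.const_mul _]
            simp only [integral_const_mul, h1, mul_one]
    have h4 : ∫ ω, |s i * g i ω| ∂μ = |s i| := by
      simp only [abs_mul, integral_const_mul, h1, mul_one]
    have h5 : μ.real {ω | s i * g i ω ≠ 0} ≤ μ.real {ω | g i ω ≠ 0} :=
      measureReal_mono fun ω hω => right_ne_zero_of_mul hω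
    simp only [Finset.sum_insert hiF]
    simp only [add_comm (s i * _)]
    rw [h4] at h2
    have h6 : 0 ≤ μ.real {ω | g i ω ≠ 0} := measureReal_nonneg
    have h7 : 0 ≤ ∑ j ∈ F, μ.real {ω | g j ω ≠ 0} := Finset.sum_nonneg fun _ _ => measureReal_nonneg
    have h8 : 0 ≤ ∫ ω, |∑ j ∈ F, s j * g j ω| ∂μ := integral_nonneg fun _ => abs_nonneg _
    have h9 := abs_nonneg (s i)
    have h10 := mul_le_mul h5 h3 h8 h6
    nlinarith [mul_nonneg h6 h9, mul_nonneg h7 h9]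

/-- A symmetric law on three points. -/
theorem exists_three_point_law {p : ℝ} (hp : 0 < p) (hp1 : p ≤ 1) :
    ∃ ν : Measure ℝ, IsProbabilityMeasure ν ∧ Integrable (fun x => x) ν ∧ ∫ x, x ∂ν = 0 ∧
      ∫ x, |x| ∂ν = 1 ∧ ν.real {x | x ≠ 0} = p := by
  let ν : Measure ℝ := ENNReal.ofReal (p / 2) • Measure.dirac p⁻¹ +
    ENNReal.ofReal (p / 2) • Measure.dirac (-p⁻¹) + ENNReal.ofReal (1 - p) • Measure.dirac 0
  have hint : ∀ f : ℝ → ℝ, ∀ x t : ℝ, Integrable f (ENNReal.ofReal t • Measure.dirac x) :=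
    fun f x t => (integrable_dirac (by simp)).smul_measure (by simp)
  have hi : ∀ f : ℝ → ℝ, Integrable f ν := fun f =>
    ((hint f _ _).add_measure (hint f _ _)).add_measure (hint f _ _)
  have hI : ∀ f : ℝ → ℝ, ∫ x, f x ∂ν = p / 2 * f p⁻¹ + p / 2 * f (-p⁻¹) + (1 - p) * f 0 :=
      fun f => by
    rw [integral_add_measure ((hint f _ _).add_measure (hint f _ _)) (hint f _ _),
      integral_add_measure (hint f _ _) (hint f _ _)]
    simp only [integral_smul_measure, integral_dirac, smul_eq_mul]
    rw [ENNReal.toReal_ofReal (by positivity), ENNReal.toReal_ofReal (by linarith)]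
  have hS : MeasurableSet {x : ℝ | x ≠ 0} := (measurableSet_singleton 0).compl
  refine ⟨ν, ⟨?_⟩, hi _, ?_, ?_, ?_⟩
  · simp only [ν, Measure.add_apply, Measure.smul_apply, measure_univ, smul_eq_mul, mul_one]
    rw [← ENNReal.ofReal_add (by positivity) (by positivity),
      ← ENNReal.ofReal_add (by positivity) (by linarith)]
    simp
  · rw [hI]; ring
  · rw [hI, abs_neg, abs_of_pos (inv_pos.mpr hp)]
    field_simp
    norm_num
  · rw [← integral_indicator_one hS, hI]
    simp [hp.ne']

end IndependentSums

/-! ### Realisation in `L¹[0,1]` -/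

section Construction

/-- Independence depends only on the joint law, so it pulls back along a measure preserving map. -/
theorem ProbabilityTheory.iIndepFun.comp_of_map_eq {ι Ω Ω' : Type*} [MeasurableSpace Ω]
    [MeasurableSpace Ω'] {μ : Measure Ω} {ν : Measure Ω'} [IsProbabilityMeasure ν] {T : Ω' → Ω}
    (hT : Measurable T) (hμ : ν.map T = μ) {β : ι → Type*} [∀ i, MeasurableSpace (β i)]
    {X : ∀ i, Ω → β i} (hX : ∀ i, Measurable (X i)) (h : iIndepFun X μ) :
    iIndepFun (fun i ω => X i (T ω)) ν := by
  have := h.isProbabilityMeasure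
  rw [iIndepFun_iff_map_fun_eq_infinitePi_map (X := fun i ω => X i (T ω)) fun i => (hX i).comp hT]
  rw [iIndepFun_iff_map_fun_eq_infinitePi_map hX, ← hμ,
    Measure.map_map (measurable_pi_lambda _ hX) hT] at h
  have h1 : ∀ i, (ν.map T).map (X i) = ν.map fun ω => X i (T ω) := fun i =>
    Measure.map_map (hX i) hT
  simp only [h1] at h
  exact h

/-- The unit interval carries independent pairs of independent variables with prescribed laws. -/
theorem exists_independent_family (P : ℕ → Bool → Measure ℝ) [∀ i b, IsProbabilityMeasure (P i b)] :
    ∃ ξ : ℕ → Bool → unitInterval → ℝ, (∀ i b, Measurable (ξ i b)) ∧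
      iIndepFun (fun q : ℕ × Bool => ξ q.1 q.2) volume ∧
      iIndepFun (fun i ω b => ξ i b ω) volume ∧
      ∀ i b, (volume : Measure unitInterval).map (ξ i b) = P i b := by
  obtain ⟨T, hT, hTμ⟩ := Measure.exists_measurable_map_eq
    (Measure.infinitePi fun i => Measure.infinitePi (P i))
  -- Independence of all variables serves the norm estimates; independence of the pairs makes the
  -- functions `fᵢ` of the pairs independent.
  refine ⟨fun i b ω => T ω i b, fun i b => by fun_prop, ?_, ?_, fun i b => ?_⟩
  · exact (iIndepFun_uncurry_infinitePi' (X := fun _ _ x => x) P (by fun_prop)).comp_of_map_eq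
      hT hTμ
      (by fun_prop)
  · exact (iIndepFun_infinitePi (P := fun i => Measure.infinitePi (P i)) (X := fun _ x => x)
      (by fun_prop)).comp_of_map_eq hT hTμ (by fun_prop)
  · change (volume : Measure unitInterval).map
      ((fun v : Bool → ℝ => v b) ∘ (fun v : ℕ → Bool → ℝ => v i) ∘ T) = P i b
    rw [← Measure.map_map (by fun_prop) (by fun_prop), ← Measure.map_map (by fun_prop) hT, hTμ,
      Measure.infinitePi_map_eval, Measure.infinitePi_map_eval]

/-- The weights, constant on the rows of `ℕ × ℕ`. -/
noncomputable def rowWeight (i : ℕ) : ℝ := (1 / 2) ^ (Nat.unpair i).1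

theorem rowWeight_pos (i : ℕ) : 0 < rowWeight i := by unfold rowWeight; positivity

/-- Independent mean zero functions on the unit interval whose span in `L¹` carries the norm of
`ℓ² ∩ ℓ¹(c)`. -/
theorem exists_independent_mixed : ∃ F : ℕ → unitInterval → ℝ, (∀ i, Measurable (F i)) ∧
    iIndepFun F volume ∧ (∀ i, Integrable (F i)) ∧ (∀ i, ∫ ω, F i ω = 0) ∧
    ∃ A B : ℝ, 0 < A ∧ 0 < B ∧ ∀ (S : Finset ℕ) (a : ℕ → ℝ),
      mixedNorm rowWeight S a ≤ A * ∫ ω, |∑ i ∈ S, a i * F i ω| ∧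
      ∫ ω, |∑ i ∈ S, a i * F i ω| ≤ B * mixedNorm rowWeight S a := by
  -- These support measures sum to `1 / 4`, which leaves the factor `1 - 2 / 4 = 1 / 2` in the `ℓ¹`
  -- estimate.
  have hp : ∀ i : ℕ, (0 : ℝ) < (1 / 2) ^ (i + 3) := fun i => by positivity
  choose ν hν hνi hν0 hν1 hνp using fun i : ℕ =>
    exists_three_point_law (hp i) (pow_le_one₀ (by norm_num) (by norm_num))
  let P : ℕ → Bool → Measure ℝ := fun i b => bif b then ν i else gaussianReal 0 1
  have hP : ∀ i b, IsProbabilityMeasure (P i b) := by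
    rintro i (_ | _)
    · exact inferInstanceAs (IsProbabilityMeasure (gaussianReal 0 1))
    · exact hν i
  have hPi : ∀ i b, Integrable (fun x => x) (P i b) := by
    rintro i (_ | _)
    · exact (memLp_id_gaussianReal' 1 (by simp)).integrable le_rfl
    · exact hνi i
  have hP0 : ∀ i b, ∫ x, x ∂(P i b) = 0 := by
    rintro i (_ | _)
    · exact integral_id_gaussianReal
    · exact hν0 i
  obtain ⟨ξ, hξm, hind, hrow, hlaw⟩ := exists_independent_family P
  have hξi : ∀ i b, Integrable (ξ i b) := fun i b => by
    have := hPi i b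
    rw [← hlaw] at this
    exact (integrable_map_measure aestronglyMeasurable_id (hξm i b).aemeasurable).mp this
  have hξ0 : ∀ i b, ∫ ω, ξ i b ω = 0 := fun i b => by
    rw [← hP0 i b, ← hlaw, integral_map (hξm i b).aemeasurable (by fun_prop)]
  have hg1 : ∀ i, ∫ ω, |ξ i true ω| = 1 := fun i => by
    rw [← hν1 i, show ν i = P i true from rfl, ← hlaw,
      integral_map (hξm i true).aemeasurable (by fun_prop)]
  have hgp : ∀ i, (volume : Measure unitInterval).real {ω | ξ i true ω ≠ 0} = (1 / 2) ^ (i + 3) :=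
    fun i => by
      rw [← hνp i, show ν i = P i true from rfl, ← hlaw, map_measureReal_apply
        (s := {x | x ≠ 0}) (hξm i true) (measurableSet_singleton 0).compl]
      rfl
  have hr : iIndepFun (fun i => ξ i false) volume :=
    hind.precomp (g := fun i : ℕ => (i, false)) fun i j h => (Prod.mk.inj h).1
  have hg : iIndepFun (fun i => ξ i true) volume :=
    hind.precomp (g := fun i : ℕ => (i, true)) fun i j h => (Prod.mk.inj h).1
  set m : ℝ := ∫ x, |x| ∂(gaussianReal 0 1) with hm
  have hm0 : 0 < m := integral_abs_gaussianReal_pos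
  have hc := rowWeight_pos
  -- In the lower estimate the Gaussian part costs `m⁻¹` and the spikes cost `2`; `m + 1` covers the
  -- triangle inequality.
  refine ⟨fun i ω => ξ i false ω + rowWeight i * ξ i true ω, fun i => ?_, ?_, fun i => ?_,
    fun i => ?_, m⁻¹ + 2, m + 1, by positivity, by positivity, fun S a => ?_⟩
  · exact (hξm i false).add ((hξm i true).const_mul _)
  · exact hrow.comp (fun i v => v false + rowWeight i * v true) fun i => by fun_prop
  · exact (hξi i false).add ((hξi i true).const_mul _)
  · rw [integral_add (hξi i false) ((hξi i true).const_mul _), integral_const_mul, hξ0, hξ0]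
    simp
  have hsplit : ∀ ω, ∑ i ∈ S, a i * (ξ i false ω + rowWeight i * ξ i true ω) =
      ∑ i ∈ S, a i * ξ i false ω + ∑ i ∈ S, (a i * rowWeight i) * ξ i true ω := fun ω => by
    rw [← Finset.sum_add_distrib]
    exact Finset.sum_congr rfl fun i _ => by ring
  simp only [hsplit]
  have hI : ∀ (b : Bool) (s : ℕ → ℝ), Integrable fun ω => ∑ i ∈ S, s i * ξ i b ω := fun b s =>
    integrable_finsetSum _ fun i _ => (hξi i b).const_mul _
  have hgauss : ∫ ω, |∑ i ∈ S, a i * ξ i false ω| = √(∑ i ∈ S, a i ^ 2) * m :=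
    integral_abs_sum_gaussian hr (fun i => hξm i false) (fun i => hlaw i false) S a
  have habs : ∑ i ∈ S, |a i * rowWeight i| = ∑ i ∈ S, rowWeight i * |a i| :=
    Finset.sum_congr rfl fun i _ => by rw [abs_mul, abs_of_pos (hc i), mul_comm]
  have hW : 0 ≤ ∑ i ∈ S, rowWeight i * |a i| :=
    Finset.sum_nonneg fun i _ => mul_nonneg (hc i).le (abs_nonneg _)
  have hspike : (1 / 2) * ∑ i ∈ S, rowWeight i * |a i| ≤
      ∫ ω, |∑ i ∈ S, (a i * rowWeight i) * ξ i true ω| := by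
    have h1 := le_integral_abs_sum_of_small_support hg (fun i => hξm i true) (fun i => hξi i true)
      hg1 S fun i => a i * rowWeight i
    simp only [hgp] at h1
    rw [habs] at h1
    have h2 : ∑ i ∈ S, (1 / 2 : ℝ) ^ (i + 3) ≤ 1 / 4 := by
      have h3 : HasSum (fun i : ℕ => (1 / 2 : ℝ) ^ (i + 3)) (1 / 4) := by
        rw [show (1 / 4 : ℝ) = 2 * (1 / 8) by norm_num,
          show (fun i : ℕ => (1 / 2 : ℝ) ^ (i + 3)) = fun i => (1 / 2) ^ i * (1 / 8) by ext i; ring]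
        exact hasSum_geometric_two.mul_right (1 / 8)
      exact sum_le_hasSum S (fun i _ => by positivity) h3
    refine le_trans (mul_le_mul_of_nonneg_right ?_ hW) h1
    linarith
  have hspike' : ∫ ω, |∑ i ∈ S, (a i * rowWeight i) * ξ i true ω| ≤
      ∑ i ∈ S, rowWeight i * |a i| := by
    calc _ ≤ ∫ ω, ∑ i ∈ S, |a i * rowWeight i| * |ξ i true ω| := by
          refine integral_mono (hI _ _).abs
            (integrable_finsetSum _ fun j _ => (hξi j true).abs.const_mul _) fun ω => ?_
          simp only [← abs_mul]
          exact Finset.abs_sum_le_sum_abs _ _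
      _ = _ := by
          rw [integral_finsetSum _ fun j _ => (hξi j true).abs.const_mul _]
          simp only [integral_const_mul, hg1, mul_one, habs]
  -- Gaussians and spikes form one independent family over `S × Bool`, so each part is a partial sum
  -- and has the smaller norm.
  let s : ℕ × Bool → ℝ := fun q => bif q.2 then a q.1 * rowWeight q.1 else a q.1
  have hle : ∀ b : Bool, ∫ ω, |∑ i ∈ S, s (i, b) * ξ i b ω| ≤
      ∫ ω, |∑ i ∈ S, a i * ξ i false ω + ∑ i ∈ S, (a i * rowWeight i) * ξ i true ω| := by
    intro b
    have h1 := (hind.const_mul s).integral_abs_sum_le (fun q => (hξm q.1 q.2).const_mul _)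
      (fun q => (hξi q.1 q.2).const_mul _) (fun q => by rw [integral_const_mul, hξ0, mul_zero])
      (Finset.product_subset_product_right (s := S) (Finset.subset_univ {b}))
    simp only [Finset.sum_product, Finset.sum_singleton, Fintype.sum_bool,
      Finset.sum_add_distrib] at h1
    refine h1.trans_eq ?_
    congr 1; ext ω
    rw [add_comm]
    rfl
  have hle1 := hle false
  have hle2 := hle true
  simp only [s, cond_false, cond_true] at hle1 hle2
  rw [hgauss] at hle1
  have hq := Real.sqrt_nonneg (∑ i ∈ S, a i ^ 2)
  unfold mixedNorm
  constructor
  · rw [add_mul]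
    refine add_le_add ?_ (by linarith)
    rw [inv_mul_eq_div, le_div_iff₀ hm0]
    exact hle1
  · have h1 : ∫ ω, |∑ i ∈ S, a i * ξ i false ω + ∑ i ∈ S, (a i * rowWeight i) * ξ i true ω| ≤
        (∫ ω, |∑ i ∈ S, a i * ξ i false ω|) + ∫ ω, |∑ i ∈ S, (a i * rowWeight i) * ξ i true ω| := by
      rw [← integral_add (hI _ _).abs (hI _ _).abs]
      exact integral_mono ((hI _ _).add (hI _ _)).abs ((hI _ _).abs.add (hI _ _).abs)
        fun ω => abs_add_le _ _
    rw [hgauss] at h1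
    nlinarith

theorem norm_sum_smul_toL1 {Ω ι : Type*} [MeasurableSpace Ω] {μ : Measure Ω} {F : ι → Ω → ℝ}
    (hF : ∀ i, Integrable (F i) μ) (S : Finset ι) (a : ι → ℝ) :
    ‖∑ i ∈ S, a i • (hF i).toL1 (F i)‖ = ∫ ω, |∑ i ∈ S, a i * F i ω| ∂μ := by
  classical
  have hI : ∀ S : Finset ι, Integrable (fun ω => ∑ i ∈ S, a i * F i ω) μ := fun S =>
    integrable_finsetSum _ fun i _ => (hF i).const_mul _
  have h1 : ∑ i ∈ S, a i • (hF i).toL1 (F i) = (hI S).toL1 _ := by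
    induction S using Finset.induction_on with
    | empty =>
      simp only [Finset.sum_empty]
      exact (Integrable.toL1_zero (integrable_zero Ω ℝ μ)).symm
    | insert i S hi ih =>
      rw [Finset.sum_insert hi, ih, ← Integrable.toL1_smul, ← Integrable.toL1_add]
      simp only [Finset.sum_insert hi]
      congr 1
  rw [h1, L1.norm_of_fun_eq_integral_norm]
  rfl

/-- Vectors are dense in the closure of their span. -/
theorem topologicalClosure_span_mk_eq_top {V ι : Type*} [NormedAddCommGroup V] [NormedSpace ℝ V]
    (f : ι → V) (hf : ∀ i, f i ∈ (Submodule.span ℝ (Set.range f)).topologicalClosure) :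
    (Submodule.span ℝ (Set.range fun i =>
      (⟨f i, hf i⟩ : (Submodule.span ℝ (Set.range f)).topologicalClosure))).topologicalClosure =
        ⊤ := by
  rw [eq_top_iff]
  rintro x -
  rw [← SetLike.mem_coe, Submodule.topologicalClosure_coe, closure_subtype]
  have h1 : Submodule.map (Submodule.span ℝ (Set.range f)).topologicalClosure.subtype
      (Submodule.span ℝ (Set.range fun i =>
        (⟨f i, hf i⟩ : (Submodule.span ℝ (Set.range f)).topologicalClosure))) =
      Submodule.span ℝ (Set.range f) := by
    rw [Submodule.map_span, ← Set.range_comp]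
    rfl
  have h2 := congrArg (fun W : Submodule ℝ V => (W : Set V)) h1
  rw [Submodule.map_coe] at h2
  change x.1 ∈ closure (Submodule.subtype _ '' _)
  rw [h2]
  exact x.2

end Construction

/-- `L¹[0,1]` is `Lp ℝ 1 volume` over the unit interval with Lebesgue measure; `ω^ω` is `ℕ → ℕ` with
the pointwise order. -/
theorem mainTheorem9 :
    ∃ Y : Submodule ℝ (Lp ℝ 1 (volume : Measure unitInterval)),
      IsClosed (Y : Set (Lp ℝ 1 (volume : Measure unitInterval))) ∧
      (∃ f : ℕ → Lp ℝ 1 (volume : Measure unitInterval),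
        iIndepFun (fun n => (f n : unitInterval → ℝ)) (volume : Measure unitInterval) ∧
        (∀ n, ∫ x, f n x = 0) ∧
        IsUnconditionalBasicSequence f ∧
        Y = (Submodule.span ℝ (Set.range f)).topologicalClosure) ∧
      (AK (Metric.closedBall (0 : Y) 1)).TukeyEquivalent
        (AsymptoticStructure.ofPoset (ℕ → ℕ)) ∧
      ¬ IsSWCG Y := by
  obtain ⟨F, hFm, hFind, hFi, hF0, A, B, hA, hB, hAB⟩ := exists_independent_mixed
  let f : ℕ → Lp ℝ 1 (volume : Measure unitInterval) := fun n => (hFi n).toL1 (F n)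
  have hnorm : ∀ (S : Finset ℕ) (a : ℕ → ℝ), ‖∑ i ∈ S, a i • f i‖ = ∫ ω, |∑ i ∈ S, a i * F i ω| :=
    fun S a => norm_sum_smul_toL1 hFi S a
  have hmem : ∀ n, f n ∈ (Submodule.span ℝ (Set.range f)).topologicalClosure := fun n =>
    Submodule.le_topologicalClosure _ (Submodule.subset_span ⟨n, rfl⟩)
  have hne : ∀ n, f n ≠ 0 := fun n h0 => by
    have h1 := (hAB {n} fun _ => 1).1
    rw [← hnorm] at h1
    simp only [mixedNorm, Finset.sum_singleton, one_pow, Real.sqrt_one, abs_one, mul_one, one_smul,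
      h0, norm_zero, mul_zero] at h1
    linarith [rowWeight_pos n]
  have hbasis : IsMixedBasis
      (fun n => (⟨f n, hmem n⟩ : (Submodule.span ℝ (Set.range f)).topologicalClosure))
      rowWeight A B := by
    refine ⟨rowWeight_pos, hA, hB, fun S a => ?_, fun S a => ?_,
      topologicalClosure_span_mk_eq_top f hmem⟩
    · rw [← Submodule.norm_coe]
      simp only [Submodule.coe_sum, Submodule.coe_smul]
      rw [hnorm]
      exact (hAB S a).1
    · rw [← Submodule.norm_coe]
      simp only [Submodule.coe_sum, Submodule.coe_smul]
      rw [hnorm]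
      exact (hAB S a).2
  have hw : Tendsto (fun n : ℕ => (1 / 2 : ℝ) ^ n) atTop (𝓝 0) :=
    tendsto_pow_atTop_nhds_zero_of_lt_one (by norm_num) (by norm_num)
  have hcw : ∀ n k, rowWeight (Nat.pair n k) = (1 / 2) ^ n := fun n k => by simp [rowWeight]
  have hcomplete : CompleteSpace (Submodule.span ℝ (Set.range f)).topologicalClosure :=
    (Submodule.isClosed_topologicalClosure _).completeSpace_coe
  refine ⟨(Submodule.span ℝ (Set.range f)).topologicalClosure,
    Submodule.isClosed_topologicalClosure _, ⟨f, ?_, fun n => ?_, ⟨hne, 1, one_pos, ?_⟩, rfl⟩,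
    ⟨hbasis.AK_tukeyReducible, hbasis.tukeyReducible_AK hw hcw⟩, hbasis.not_isSWCG hw hcw⟩
  · exact hFind.congr fun n => ((hFi n).coeFn_toL1).symm
  · rw [integral_congr_ae (hFi n).coeFn_toL1, hF0]
  · intro G S hGS a
    rw [one_mul, hnorm, hnorm]
    exact (hFind.const_mul a).integral_abs_sum_le (fun n => (hFm n).const_mul _)
      (fun n => (hFi n).const_mul _) (fun n => by rw [integral_const_mul, hF0, mul_zero]) hGS
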